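/- Let $p\in[0,1]$. The binary-input no-adjacent-erasures (BINAEras) channel with parameter $p$ has input sequence $x_1,x_2,\dots$ with $x_i\in\{0,1\}$ and output sequence $y_1,y_2,\dots$ with $y_i\in\{0,1,\mathrm{e}\}$, where $\mathrm{e}$ is an erasure symbol, given by $y_i=x_i$ if $u_i=0$ and $y_i=\mathrm{e}$ if $u_i=1$. Here $u_1,u_2,\dots$ is a Markov chain on $\{0,1\}$, independent of the input sequence, with transition probabilities $P(u_i=1\mid u_{i-1}=0)=p$, $P(u_i=0\mid u_{i-1}=0)=1-p$, $P(u_i=0\mid u_{i-1}=1)=1$, $P(u_i=1\mid u_{i-1}=1)=0$, started from an initial state $u_0\in\{0,1\}$. Write $x^n=(x_1,\dots,x_n)$, $y^n=(y_1,\dots,y_n)$, let $Q^n$ range over all probability distributions of $x^n$ on $\{0,1\}^n$, and let $I(x^n;y^n\mid u_0)$ denote the mutual information in bits between $x^n$ and $y^n$ given the value $u_0$ of the initial state. Define the lower and upper capacities by $$\underline{C}=\lim_{n\to\infty}\frac1n\max_{Q^n}\min_{u_0\in\{0,1\}}I(x^n;y^n\mid u_0),\qquad \overline{C}=\lim_{n\to\infty}\frac1n\max_{Q^n}\max_{u_0\in\{0,1\}}I(x^n;y^n\mid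 u_0).$$ Then the maxima and both limits exist, and $\underline{C}=\overline{C}=\dfrac{1}{1+p}$. -/

import Mathlib

open Filter Topology

/-- Mutual information, in bits, of two random variables with values in the finite types `α`, `β`
and joint probability mass function `P`:
`∑ P(a,b) log₂ (P(a,b) / (P_A(a) P_B(b)))`, where terms with `P(a,b) = 0` vanish. -/
noncomputable def mutualInfoBits {α β : Type*} [Fintype α] [Fintype β] (P : α → β → ℝ) : ℝ :=
  ∑ a, ∑ b, P a b * Real.logb 2 (P a b / ((∑ b', P a b') * (∑ a', P a' b)))

/-- A stationary discrete finite-state channel with input alphabet `X`, output alphabet `Y` and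
state set `S`: `prob x s y s'` is the conditional probability `P(yₙ = y, sₙ = s' ∣ xₙ = x, sₙ₋₁ = s)`. -/
structure DFSC (X Y S : Type*) [Fintype Y] [Fintype S] where
  prob : X → S → Y → S → ℝ
  prob_nonneg : ∀ x s y s', 0 ≤ prob x s y s'
  prob_sum : ∀ x s, ∑ y, ∑ s', prob x s y s' = 1

namespace DFSC

variable {X Y S : Type*} [Fintype X] [Fintype Y] [Fintype S]

/-- `P(yⁿ ∣ xⁿ, s₀)`: the probability of the output word `y` given the input word `x` and the
initial state `s₀`, obtained by summing over all state sequences `s₁, …, sₙ`. -/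
noncomputable def outProb (W : DFSC X Y S) {n : ℕ} (s₀ : S) (x : Fin n → X) (y : Fin n → Y) : ℝ :=
  ∑ s : Fin n → S,
    ∏ i : Fin n, W.prob (x i) ((Fin.cons s₀ s : Fin (n + 1) → S) i.castSucc) (y i) (s i)

/-- `I(xⁿ; yⁿ ∣ s₀)` (in bits) for the input distribution `Q` on words of length `n` and the given
value `s₀` of the initial state. -/
noncomputable def blockInfo (W : DFSC X Y S) {n : ℕ} (Q : (Fin n → X) → ℝ) (s₀ : S) : ℝ :=
  mutualInfoBits fun (x : Fin n → X) (y : Fin n → Y) => Q x * W.outProb s₀ x y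

/-- `C` is the lower capacity of the channel: the maxima over input distributions
`max_Q min_{s₀} I(xⁿ; yⁿ ∣ s₀)` exist, and after division by `n` they converge to `C`. -/
def IsLowerCapacity [Nonempty S] (W : DFSC X Y S) (C : ℝ) : Prop :=
  ∃ M : ℕ → ℝ,
    (∀ n, IsGreatest ((fun Q : (Fin n → X) → ℝ =>
      Finset.univ.inf' Finset.univ_nonempty fun s₀ : S => W.blockInfo Q s₀) ''
        stdSimplex ℝ (Fin n → X)) (M n)) ∧
    Tendsto (fun n : ℕ => (n : ℝ)⁻¹ * M n) atTop (𝓝 C)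

/-- `C` is the upper capacity of the channel: the maxima over input distributions
`max_Q max_{s₀} I(xⁿ; yⁿ ∣ s₀)` exist, and after division by `n` they converge to `C`. -/
def IsUpperCapacity [Nonempty S] (W : DFSC X Y S) (C : ℝ) : Prop :=
  ∃ M : ℕ → ℝ,
    (∀ n, IsGreatest ((fun Q : (Fin n → X) → ℝ =>
      Finset.univ.sup' Finset.univ_nonempty fun s₀ : S => W.blockInfo Q s₀) ''
        stdSimplex ℝ (Fin n → X)) (M n)) ∧
    Tendsto (fun n : ℕ => (n : ℝ)⁻¹ * M n) atTop (𝓝 C)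

end DFSC

/-- Transition probabilities `P(uᵢ = u' ∣ uᵢ₋₁ = u)` of the binary Markov chain driving the
erasures (`true` is the symbol `1`, `false` is the symbol `0`). -/
def erasureTrans (p : ℝ) : Bool → Bool → ℝ
  | false, false => 1 - p
  | false, true => p
  | true, false => 1
  | true, true => 0

/-- The output symbol for input `x` and noise symbol `u`: `x` if `u = 0`, and the erasure symbol
`none` if `u = 1`. -/
def erasureOutput (x u : Bool) : Option Bool :=
  if u then none else some x

/-- The binary-input no-adjacent-erasures channel with parameter `p ∈ [0,1]`. Its state after step
`n` is `uₙ`; the noise moves independently of the input. -/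
def binaEras (p : ℝ) (hp : p ∈ Set.Icc (0 : ℝ) 1) : DFSC Bool (Option Bool) Bool where
  prob x u y u' := erasureTrans p u u' * (if y = erasureOutput x u' then 1 else 0)
  prob_nonneg x u y u' := by
    obtain ⟨h0, h1⟩ := hp
    refine mul_nonneg ?_ (by split_ifs <;> norm_num)
    cases u <;> cases u' <;> simp [erasureTrans] <;> linarith
  prob_sum x u := by
    rw [Finset.sum_comm]
    cases u <;> simp [erasureTrans]

/-! The output shows which positions were erased, so the information over a block is the average,
over noise words `u`, of the entropy of the unerased part of the input (`blockInfo_binaEras`). That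
entropy is at most `unerased u` bits (`sum_neg_logb_agreeProb_le`), with equality for every `u`
under the uniform input. Hence one input is optimal for both initial states at once, and the maxima
are the minimum and maximum over `s` of `expectedUnerased p n s`. A recursion on the first noise
symbol puts this within 1 of `n / (1 + p)`. -/

/-- Probability of the noise word `u₁, …, uₙ` given the initial noise state `u₀ = s`. -/
noncomputable def noiseProb (p : ℝ) {n : ℕ} (s : Bool) (u : Fin n → Bool) : ℝ :=
  ∏ i : Fin n, erasureTrans p ((Fin.cons s u : Fin (n + 1) → Bool) i.castSucc) (u i)

/-- The output word for the input word `x` and the noise word `u`. -/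
def erasureWord {n : ℕ} (x u : Fin n → Bool) : Fin n → Option Bool :=
  fun i => erasureOutput (x i) (u i)

/-- The number of positions that are not erased by the noise word `u`. -/
def unerased {n : ℕ} (u : Fin n → Bool) : ℕ :=
  ∑ i, if u i then 0 else 1

/-- The expected number of unerased positions in a block of length `n`. -/
noncomputable def expectedUnerased (p : ℝ) (n : ℕ) (s : Bool) : ℝ :=
  ∑ u : Fin n → Bool, noiseProb p s u * unerased u

/-- The probability under `Q` that the input word agrees with `x` off the positions erased
by `u`. -/
noncomputable def agreeProb {n : ℕ} (Q : (Fin n → Bool) → ℝ) (x u : Fin n → Bool) : ℝ :=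
  ∑ x', Q x' * if erasureWord x' u = erasureWord x u then 1 else 0

lemma erasureTrans_nonneg {p : ℝ} (hp : p ∈ Set.Icc (0 : ℝ) 1) (a b : Bool) :
    0 ≤ erasureTrans p a b := by
  obtain ⟨h0, h1⟩ := hp
  cases a <;> cases b <;> simp [erasureTrans] <;> linarith

lemma noiseProb_nonneg {p : ℝ} (hp : p ∈ Set.Icc (0 : ℝ) 1) {n : ℕ} (s : Bool)
    (u : Fin n → Bool) : 0 ≤ noiseProb p s u :=
  Finset.prod_nonneg fun _ _ => erasureTrans_nonneg hp _ _

lemma noiseProb_cons (p : ℝ) {n : ℕ} (s a : Bool) (u : Fin n → Bool) :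
    noiseProb p s (Fin.cons a u : Fin (n + 1) → Bool) = erasureTrans p s a * noiseProb p a u := by
  simp [noiseProb, Fin.prod_univ_succ]

lemma unerased_cons {n : ℕ} (a : Bool) (u : Fin n → Bool) :
    unerased (Fin.cons a u : Fin (n + 1) → Bool) = (if a then 0 else 1) + unerased u := by
  simp [unerased, Fin.sum_univ_succ]

lemma sum_fin_succ_bool {n : ℕ} (f : (Fin (n + 1) → Bool) → ℝ) :
    ∑ u, f u = ∑ u : Fin n → Bool, f (Fin.cons true u) + ∑ u : Fin n → Bool, f (Fin.cons false u) := by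
  rw [← (Fin.consEquiv fun _ => Bool).sum_comp, Fintype.sum_prod_type]
  simp [Fin.consEquiv]

lemma sum_noiseProb (p : ℝ) (n : ℕ) (s : Bool) : ∑ u : Fin n → Bool, noiseProb p s u = 1 := by
  induction n generalizing s with
  | zero => simp [noiseProb]
  | succ n ih =>
    simp only [sum_fin_succ_bool, noiseProb_cons, ← Finset.mul_sum, ih]
    cases s <;> simp [erasureTrans]

lemma expectedUnerased_succ (p : ℝ) (n : ℕ) (s : Bool) :
    expectedUnerased p (n + 1) s = erasureTrans p s true * expectedUnerased p n true +
      erasureTrans p s false * (1 + expectedUnerased p n false) := by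
  have h := sum_noiseProb p n false
  simp only [expectedUnerased, sum_fin_succ_bool, noiseProb_cons, unerased_cons]
  rw [← h, ← Finset.sum_add_distrib (f := fun u => noiseProb p false u), Finset.mul_sum,
    Finset.mul_sum]
  congr 1 <;> refine Finset.sum_congr rfl fun u _ => ?_ <;> simp <;> ring

/-- The correction `p / (1 + p)` for an erased initial state makes the main term solve the recursion
exactly. The error at `n = 0` lies in `[-1, 0]` and is afterwards only averaged. -/
lemma expectedUnerased_bounds {p : ℝ} (hp : p ∈ Set.Icc (0 : ℝ) 1) (n : ℕ) (s : Bool) :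
    n * (1 / (1 + p)) + (if s then p / (1 + p) else 0) - 1 ≤ expectedUnerased p n s ∧
      expectedUnerased p n s ≤ n * (1 / (1 + p)) + (if s then p / (1 + p) else 0) := by
  obtain ⟨h0, h1⟩ := hp
  have hpos : 0 < 1 + p := by linarith
  induction n generalizing s with
  | zero =>
    have h2 : p / (1 + p) ≤ 1 := by rw [div_le_one hpos]; linarith
    have h3 : 0 ≤ p / (1 + p) := by positivity
    cases s <;> simp [expectedUnerased, unerased, h2, h3]
  | succ n ih =>
    obtain ⟨a1, a2⟩ := ih true
    obtain ⟨b1, b2⟩ := ih false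
    have hc : p / (1 + p) = 1 - 1 / (1 + p) := by field_simp; ring
    have hd : p * (1 / (1 + p)) = 1 - 1 / (1 + p) := by field_simp; ring
    rw [expectedUnerased_succ]
    generalize p / (1 + p) = d at *
    generalize 1 / (1 + p) = c at *
    subst hc
    simp only [if_true, Bool.false_eq_true, if_false] at a1 a2 b1 b2
    cases s
    · have e1 := mul_le_mul_of_nonneg_left a1 h0
      have e2 := mul_le_mul_of_nonneg_left a2 h0
      have e3 := mul_le_mul_of_nonneg_left b1 (sub_nonneg.2 h1)
      have e4 := mul_le_mul_of_nonneg_left b2 (sub_nonneg.2 h1)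
      simp only [erasureTrans, Bool.false_eq_true, if_false]
      push_cast
      constructor <;> nlinarith
    · simp only [erasureTrans, if_true]
      push_cast
      constructor <;> linarith

/-- Erasure symbols occur exactly where the noise is `true`, so an output word determines its noise
word. -/
lemma erasureWord_eq_iff {n : ℕ} (x x' u u' : Fin n → Bool) :
    erasureWord x u = erasureWord x' u' ↔
      u = u' ∧ erasureWord x' u = erasureWord x u := by
  simp only [funext_iff, ← forall_and, erasureWord]
  refine forall_congr' fun i => ?_
  generalize x i = a; generalize x' i = b; generalize u i = c; generalize u' i = d
  revert a b c d
  decide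

lemma outProb_binaEras {p : ℝ} (hp : p ∈ Set.Icc (0 : ℝ) 1) {n : ℕ} (s : Bool)
    (x : Fin n → Bool) (y : Fin n → Option Bool) :
    (binaEras p hp).outProb s x y =
      ∑ u, noiseProb p s u * if y = erasureWord x u then 1 else 0 := by
  simp only [DFSC.outProb, binaEras, Finset.prod_mul_distrib, noiseProb, Finset.prod_ite_zero,
    funext_iff, erasureWord, Finset.prod_const_one, Finset.mem_univ, forall_true_left]

lemma outProb_binaEras_erasureWord {p : ℝ} (hp : p ∈ Set.Icc (0 : ℝ) 1) {n : ℕ} (s : Bool)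
    (x x' u : Fin n → Bool) :
    (binaEras p hp).outProb s x' (erasureWord x u) =
      noiseProb p s u * if erasureWord x' u = erasureWord x u then 1 else 0 := by
  simp only [outProb_binaEras, erasureWord_eq_iff x x' u, ite_and, mul_ite, mul_one, mul_zero]
  simp

lemma sum_outProb_binaEras_mul {p : ℝ} (hp : p ∈ Set.Icc (0 : ℝ) 1) {n : ℕ} (s : Bool)
    (x : Fin n → Bool) (F : (Fin n → Option Bool) → ℝ) :
    ∑ y, (binaEras p hp).outProb s x y * F y = ∑ u, noiseProb p s u * F (erasureWord x u) := by
  simp only [outProb_binaEras, Finset.sum_mul]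
  rw [Finset.sum_comm]
  simp

lemma agreeProb_pos {n : ℕ} {Q : (Fin n → Bool) → ℝ} (hQ : ∀ x, 0 ≤ Q x) {x : Fin n → Bool}
    (hx : 0 < Q x) (u : Fin n → Bool) : 0 < agreeProb Q x u := by
  refine Finset.sum_pos' (fun x' _ => mul_nonneg (hQ x') (by split_ifs <;> norm_num)) ⟨x, ?_⟩
  simpa using hx

/-- Since the output determines `u`, the factor `noiseProb p s u` occurs in both the joint and the
output probability and cancels inside the logarithm. -/
lemma blockInfo_binaEras {p : ℝ} (hp : p ∈ Set.Icc (0 : ℝ) 1) {n : ℕ} {Q : (Fin n → Bool) → ℝ}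
    (hQ : ∀ x, 0 ≤ Q x) (s : Bool) :
    (binaEras p hp).blockInfo Q s =
      ∑ u, noiseProb p s u * ∑ x, Q x * -Real.logb 2 (agreeProb Q x u) := by
  have hsum : ∀ x : Fin n → Bool, ∑ y, Q x * (binaEras p hp).outProb s x y = Q x := fun x => by
    have := sum_outProb_binaEras_mul hp s x fun _ => 1
    simp only [mul_one, sum_noiseProb] at this
    rw [← Finset.mul_sum, this, mul_one]
  simp only [DFSC.blockInfo, mutualInfoBits, hsum, mul_assoc (Q _)]
  simp only [← Finset.mul_sum, sum_outProb_binaEras_mul, outProb_binaEras_erasureWord]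
  trans ∑ x, ∑ u, noiseProb p s u * (Q x * -Real.logb 2 (agreeProb Q x u))
  swap
  · rw [Finset.sum_comm]
    simp only [Finset.mul_sum]
  refine Finset.sum_congr rfl fun x _ => ?_
  rw [Finset.mul_sum]
  refine Finset.sum_congr rfl fun u _ => ?_
  have hm : ∑ x', Q x' * (noiseProb p s u *
      if erasureWord x' u = erasureWord x u then 1 else 0) = noiseProb p s u * agreeProb Q x u := by
    rw [agreeProb, Finset.mul_sum]
    exact Finset.sum_congr rfl fun _ _ => by ring
  rw [hm]
  rcases (hQ x).eq_or_lt with h | h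
  · simp [← h]
  rcases (noiseProb_nonneg hp s u).eq_or_lt with h' | h'
  · simp [← h']
  have hpos := agreeProb_pos hQ h u
  have : Q x * (noiseProb p s u * if True then 1 else 0) /
      (Q x * (noiseProb p s u * agreeProb Q x u)) = (agreeProb Q x u)⁻¹ := by
    rw [if_pos trivial]; field_simp
  rw [this, Real.logb_inv]
  ring

lemma sum_ite_erasureWord_eq {n : ℕ} (x u : Fin n → Bool) :
    ∑ x', (if erasureWord x' u = erasureWord x u then (1 : ℝ) else 0) =
      2 ^ n * (2 ^ unerased u)⁻¹ := by
  have h1 : ∀ x', (if erasureWord x' u = erasureWord x u then (1 : ℝ) else 0) =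
      ∏ i, if erasureOutput (x' i) (u i) = erasureOutput (x i) (u i) then (1 : ℝ) else 0 := by
    intro x'
    simp only [Finset.prod_ite_zero, funext_iff, erasureWord, Finset.prod_const_one,
      Finset.mem_univ, forall_true_left]
  simp only [h1]
  rw [← Fintype.prod_sum fun (i : Fin n) (b : Bool) =>
    if erasureOutput b (u i) = erasureOutput (x i) (u i) then (1 : ℝ) else 0]
  have h2 : (2 : ℝ) ^ n = ∏ _i : Fin n, 2 := by simp
  rw [unerased, ← Finset.prod_pow_eq_pow_sum, h2, ← Finset.prod_inv_distrib,
    ← Finset.prod_mul_distrib]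
  refine Finset.prod_congr rfl fun i _ => ?_
  cases u i <;> cases x i <;> norm_num [erasureOutput]

lemma agreeProb_uniform {n : ℕ} (x u : Fin n → Bool) :
    agreeProb (fun _ => ((2 : ℝ) ^ n)⁻¹) x u = (2 ^ unerased u)⁻¹ := by
  rw [agreeProb, ← Finset.mul_sum, sum_ite_erasureWord_eq, inv_mul_cancel_left₀ (by positivity)]

lemma agreeProb_congr {n : ℕ} (Q : (Fin n → Bool) → ℝ) {x x' u : Fin n → Bool}
    (h : erasureWord x' u = erasureWord x u) : agreeProb Q x' u = agreeProb Q x u := by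
  simp only [agreeProb, h]

/-- Each class of words agreeing off the erased positions contributes at most 1, and there are `2 ^
unerased u` classes. Weighting by the common class size turns this into a double count over pairs of
words. -/
lemma sum_div_agreeProb_le {n : ℕ} (Q : (Fin n → Bool) → ℝ) (u : Fin n → Bool) :
    ∑ x, Q x / agreeProb Q x u ≤ 2 ^ unerased u := by
  have hn : (0 : ℝ) < 2 ^ n * (2 ^ unerased u)⁻¹ := by positivity
  refine le_of_mul_le_mul_left ?_ hn
  rw [inv_mul_cancel_right₀ (by positivity), Finset.mul_sum]
  calc ∑ x, 2 ^ n * (2 ^ unerased u)⁻¹ * (Q x / agreeProb Q x u)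
      = ∑ x', ∑ x, (Q x * if erasureWord x u = erasureWord x' u then 1 else 0) /
          agreeProb Q x' u := by
        rw [Finset.sum_comm]
        refine Finset.sum_congr rfl fun x _ => ?_
        rw [← sum_ite_erasureWord_eq x u, Finset.sum_mul]
        refine Finset.sum_congr rfl fun x' _ => ?_
        by_cases h : erasureWord x' u = erasureWord x u
        · simp [h, agreeProb_congr Q h]
        · simp [h, Ne.symm h]
    _ = ∑ x', agreeProb Q x' u / agreeProb Q x' u := by
        simp only [← Finset.sum_div]; rfl
    -- Classes of mass zero give `0 / 0 = 0`, hence only an inequality.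
    _ ≤ ∑ _x' : Fin n → Bool, (1 : ℝ) := Finset.sum_le_sum fun _ _ => div_self_le_one _
    _ = 2 ^ n := by simp

/-- The entropy of the unerased part of the input word is at most the number of unerased
positions. -/
lemma sum_neg_logb_agreeProb_le {n : ℕ} {Q : (Fin n → Bool) → ℝ}
    (hQ : Q ∈ stdSimplex ℝ (Fin n → Bool)) (u : Fin n → Bool) :
    ∑ x, Q x * -Real.logb 2 (agreeProb Q x u) ≤ unerased u := by
  have hl : 0 < Real.log 2 := Real.log_pos one_lt_two
  -- Gibbs' inequality against the uniform law on classes: `log t ≤ t - 1` at `t = 2 ^ (-unerased u)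
  -- / agreeProb Q x u`.
  have key : ∀ x, Q x * -Real.logb 2 (agreeProb Q x u) ≤ Q x * unerased u +
      ((2 ^ unerased u)⁻¹ * (Q x / agreeProb Q x u) - Q x) / Real.log 2 := by
    intro x
    rcases (hQ.1 x).eq_or_lt with h | h
    · simp [← h]
    have hpos := agreeProb_pos hQ.1 h u
    have h1 := Real.log_le_sub_one_of_pos
      (show 0 < (2 ^ unerased u)⁻¹ / agreeProb Q x u by positivity)
    rw [Real.log_div (by positivity) hpos.ne', Real.log_inv, Real.log_pow] at h1
    have h2 : Real.logb 2 (agreeProb Q x u) * Real.log 2 = Real.log (agreeProb Q x u) :=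
      div_mul_cancel₀ _ hl.ne'
    have h3 := mul_le_mul_of_nonneg_left h1 h.le
    rw [← sub_le_iff_le_add', le_div_iff₀ hl]
    calc _ = Q x * (-(unerased u * Real.log 2) - Real.log (agreeProb Q x u)) := by
          rw [← h2]; ring
      _ ≤ _ := h3
      _ = _ := by ring
  refine (Finset.sum_le_sum fun x _ => key x).trans ?_
  rw [Finset.sum_add_distrib, ← Finset.sum_mul, hQ.2, ← Finset.sum_div, Finset.sum_sub_distrib,
    hQ.2, ← Finset.mul_sum, one_mul, add_le_iff_nonpos_right]
  refine div_nonpos_of_nonpos_of_nonneg (sub_nonpos.2 ?_) hl.le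
  rw [inv_mul_le_one₀ (by positivity)]
  exact sum_div_agreeProb_le Q u

lemma blockInfo_binaEras_le {p : ℝ} (hp : p ∈ Set.Icc (0 : ℝ) 1) {n : ℕ}
    {Q : (Fin n → Bool) → ℝ} (hQ : Q ∈ stdSimplex ℝ (Fin n → Bool)) (s : Bool) :
    (binaEras p hp).blockInfo Q s ≤ expectedUnerased p n s := by
  rw [blockInfo_binaEras hp hQ.1]
  exact Finset.sum_le_sum fun u _ =>
    mul_le_mul_of_nonneg_left (sum_neg_logb_agreeProb_le hQ u) (noiseProb_nonneg hp s u)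

lemma uniform_mem_stdSimplex (n : ℕ) :
    (fun _ => ((2 : ℝ) ^ n)⁻¹) ∈ stdSimplex ℝ (Fin n → Bool) :=
  ⟨fun _ => by positivity, by simp⟩

lemma blockInfo_binaEras_uniform {p : ℝ} (hp : p ∈ Set.Icc (0 : ℝ) 1) (n : ℕ) (s : Bool) :
    (binaEras p hp).blockInfo (fun _ : Fin n → Bool => ((2 : ℝ) ^ n)⁻¹) s =
      expectedUnerased p n s := by
  rw [blockInfo_binaEras hp (uniform_mem_stdSimplex n).1]
  refine Finset.sum_congr rfl fun u _ => ?_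
  simp only [agreeProb_uniform, ← Finset.sum_mul, (uniform_mem_stdSimplex n).2]
  rw [Real.logb_inv, Real.logb_pow, Real.logb_self_eq_one one_lt_two]
  simp

lemma tendsto_inv_mul_of_bounds {M : ℕ → ℝ} {c : ℝ}
    (h : ∀ n : ℕ, n * c - 1 ≤ M n ∧ M n ≤ n * c + 1) :
    Tendsto (fun n : ℕ => (n : ℝ)⁻¹ * M n) atTop (𝓝 c) := by
  have hi := tendsto_inv_atTop_nhds_zero_nat (𝕜 := ℝ)
  have hl : Tendsto (fun n : ℕ => c - (n : ℝ)⁻¹) atTop (𝓝 c) := by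
    simpa using tendsto_const_nhds.sub hi
  have hu : Tendsto (fun n : ℕ => c + (n : ℝ)⁻¹) atTop (𝓝 c) := by
    simpa using tendsto_const_nhds.add hi
  refine tendsto_of_tendsto_of_tendsto_of_le_of_le' hl hu ?_ ?_ <;>
    filter_upwards [eventually_gt_atTop 0] with n hn <;>
    have hn' : (0 : ℝ) < n := Nat.cast_pos.2 hn
  · rw [← div_eq_inv_mul, le_div_iff₀ hn', sub_mul, inv_mul_cancel₀ hn'.ne', mul_comm]
    exact (h n).1
  · rw [← div_eq_inv_mul, div_le_iff₀ hn', add_mul, inv_mul_cancel₀ hn'.ne', mul_comm]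
    exact (h n).2

lemma expectedUnerased_mem {p : ℝ} (hp : p ∈ Set.Icc (0 : ℝ) 1) (n : ℕ) (s : Bool) :
    n * (1 / (1 + p)) - 1 ≤ expectedUnerased p n s ∧
      expectedUnerased p n s ≤ n * (1 / (1 + p)) + 1 := by
  have h := expectedUnerased_bounds hp n s
  have hpos : 0 < 1 + p := by linarith [hp.1]
  have h2 : p / (1 + p) ≤ 1 := by rw [div_le_one hpos]; linarith
  have h3 : 0 ≤ p / (1 + p) := div_nonneg hp.1 hpos.le
  cases s <;> simp only [if_true, Bool.false_eq_true, if_false] at h <;>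
    constructor <;> linarith [h.1, h.2]

theorem mainTheorem3 (p : ℝ) (hp : p ∈ Set.Icc (0 : ℝ) 1) :
    (binaEras p hp).IsLowerCapacity (1 / (1 + p)) ∧
      (binaEras p hp).IsUpperCapacity (1 / (1 + p)) := by
  constructor
  -- The uniform input meets the upper bound in every state, so it attains the maximum of the
  -- minimum as well.
  · refine ⟨fun n => Finset.univ.inf' Finset.univ_nonempty (expectedUnerased p n),
      fun n => ⟨⟨_, uniform_mem_stdSimplex n, ?_⟩, ?_⟩, tendsto_inv_mul_of_bounds fun n => ⟨?_, ?_⟩⟩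
    · simp only [blockInfo_binaEras_uniform]
    · rintro _ ⟨Q, hQ, rfl⟩
      exact Finset.inf'_mono_fun fun s _ => blockInfo_binaEras_le hp hQ s
    · exact Finset.le_inf' _ _ fun s _ => (expectedUnerased_mem hp n s).1
    · exact (Finset.inf'_le _ (Finset.mem_univ false)).trans (expectedUnerased_mem hp n false).2
  · refine ⟨fun n => Finset.univ.sup' Finset.univ_nonempty (expectedUnerased p n),
      fun n => ⟨⟨_, uniform_mem_stdSimplex n, ?_⟩, ?_⟩, tendsto_inv_mul_of_bounds fun n => ⟨?_, ?_⟩⟩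
    · simp only [blockInfo_binaEras_uniform]
    · rintro _ ⟨Q, hQ, rfl⟩
      exact Finset.sup'_mono_fun fun s _ => blockInfo_binaEras_le hp hQ s
    · exact (expectedUnerased_mem hp n false).1.trans (Finset.le_sup' _ (Finset.mem_univ false))
    · exact Finset.sup'_le _ _ fun s _ => (expectedUnerased_mem hp n s).2
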